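/- Let $\mathbb K$ be an algebraically closed field of characteristic zero, and let $\mathcal P(t)=(p_1(t):p_2(t):p(t))$, with $p_1,p_2,p\in\mathbb K[t]$ and $\gcd(p_1,p_2,p)=1$, be a proper parametrization of a plane curve $\mathcal C\subset\mathbb P^2(\mathbb K)$ that is not a line; that is, $\mathcal C$ is the Zariski closure of $\{\mathcal P(t): t\in\mathbb K\}$ and the map $t\mapsto\mathcal P(t)$ is birational onto $\mathcal C$ (it has degree $1$). Put $d=\max\{\deg p_1,\deg p_2,\deg p\}$ and let $a_d,b_d,c_d$ be the coefficients of $t^d$ in $p_1,p_2,p$. The limit point of $\mathcal P$ is $P_L=(a_d:b_d:c_d)$. For a triple of polynomials $(q_1,q_2,q)$, the fibre function of $P_L$ is $\gcd(a_dq-c_dq_1,\ b_dq-c_dq_2,\ a_dq_2-b_dq_1)$. Let $H_L$ be the fibre function of $P_L$ for $(p_1,p_2,p)$, and let $H_L^{\mathcal U}$ be the fibre function of $P_L$ for the triple $(t^dp_1(1/t),\,t^dp_2(1/t),\,t^dp(1/t))$, which represents $\mathcal U(t)=\mathcal P(1/t)$. The visible multiplicity of $P_L$ is $\deg H_L$,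 and its hidden multiplicity $m_H$ is the exponent of $t$ in $H_L^{\mathcal U}$. If $P_L$ is reached by the parametrization, i.e. $\mathcal P(t_0)=P_L$ for some $t_0\in\mathbb K$, then $P_L$ is a singular point of $\mathcal C$ (a point of multiplicity at least $2$). More precisely, $$\operatorname{mult}_{P_L}(\mathcal C)=\deg H_L+m_H,\qquad \deg H_L\ge 1,\qquad m_H\ge 1 .$$ -/

import Mathlib

open Polynomial
open scoped LinearAlgebra.Projectivization

noncomputable section

/-- The projective plane over `K`. -/
abbrev ProjPlane (K : Type*) [Field K] : Type _ := ℙ K (Fin 3 → K)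

/-- The form `F` vanishes at the point `x` (for homogeneous `F` this does not depend on the
representative of `x`). -/
def VanishesAt {K : Type*} [Field K] (F : MvPolynomial (Fin 3) K) (x : ProjPlane K) : Prop :=
  MvPolynomial.eval x.rep F = 0

/-- The homogeneous forms that vanish on a set of points of the projective plane. -/
def vanishingForms {K : Type*} [Field K] (S : Set (ProjPlane K)) :
    Set (MvPolynomial (Fin 3) K) :=
  {F | (∃ n : ℕ, F.IsHomogeneous n) ∧ ∀ x ∈ S, VanishesAt F x}

/-- The homogeneous ideal of a set of points of the projective plane. -/
def homogeneousIdeal {K : Type*} [Field K] (S : Set (ProjPlane K)) :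
    Ideal (MvPolynomial (Fin 3) K) :=
  Ideal.span (vanishingForms S)

/-- The Zariski closure of a set of points of the projective plane. -/
def projZariskiClosure {K : Type*} [Field K] (S : Set (ProjPlane K)) : Set (ProjPlane K) :=
  {x | ∀ F ∈ vanishingForms S, VanishesAt F x}

/-- `F` is a defining form of the plane curve `C`: a homogeneous generator of the ideal of `C`. -/
def IsDefiningForm {K : Type*} [Field K] (C : Set (ProjPlane K))
    (F : MvPolynomial (Fin 3) K) : Prop :=
  (∃ n : ℕ, F.IsHomogeneous n) ∧ Ideal.span {F} = homogeneousIdeal C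

/-- The order of vanishing of `F` at `x`: the least degree of a nonzero homogeneous component of
`F (v + X)`, where `v` represents `x`. -/
def orderAt {K : Type*} [Field K] (F : MvPolynomial (Fin 3) K) (x : ProjPlane K) : ℕ :=
  sInf {k : ℕ | MvPolynomial.homogeneousComponent k
    (MvPolynomial.aeval
      (fun i : Fin 3 => (MvPolynomial.X i + MvPolynomial.C (x.rep i) : MvPolynomial (Fin 3) K))
      F) ≠ 0}

/-- The multiplicity of the plane curve `C` at `x`: the order of vanishing at `x` of a defining
form of `C`. Defining forms of `C` differ by constant factors, so for a curve the set below has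
exactly one element. -/
def curveMultiplicity {K : Type*} [Field K] (C : Set (ProjPlane K)) (x : ProjPlane K) : ℕ :=
  sInf {m : ℕ | ∃ F, IsDefiningForm C F ∧ orderAt F x = m}

/-- `x` is a singular point of the plane curve `C`: a point of `C` of multiplicity at least 2. -/
def IsSingularPoint {K : Type*} [Field K] (C : Set (ProjPlane K)) (x : ProjPlane K) : Prop :=
  x ∈ C ∧ 2 ≤ curveMultiplicity C x

/-- `C` is a line of the projective plane. -/
def IsProjLine {K : Type*} [Field K] (C : Set (ProjPlane K)) : Prop :=
  ∃ a : Fin 3 → K, a ≠ 0 ∧ C = {x | ∑ i, a i * x.rep i = 0}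

open Classical in
/-- The fibre function of the point with homogeneous coordinates `v = (a, b, c)` with respect to
the triple `p = (p₁, p₂, p₃)`: the gcd (determined up to a constant factor) of
`a p₃ - c p₁`, `b p₃ - c p₂` and `a p₂ - b p₁`. -/
def fibreFunction {K : Type*} [Field K] (p : Fin 3 → K[X]) (v : Fin 3 → K) : K[X] :=
  EuclideanDomain.gcd (C (v 0) * p 2 - C (v 2) * p 0)
    (EuclideanDomain.gcd (C (v 1) * p 2 - C (v 2) * p 1) (C (v 0) * p 1 - C (v 1) * p 0))

/-- A projective polynomial parametrization `(p₁(t) : p₂(t) : p₃(t))` with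
`gcd (p₁, p₂, p₃) = 1`. -/
structure PlaneParametrization (K : Type*) [Field K] where
  /-- The coordinate polynomials. -/
  coords : Fin 3 → K[X]
  gcd_eq_one : ∀ q : K[X], (∀ i, q ∣ coords i) → IsUnit q

namespace PlaneParametrization

variable {K : Type*} [Field K] (P : PlaneParametrization K)

/-- The maximum `d` of the degrees of the coordinate polynomials. -/
def deg : ℕ := Finset.univ.sup fun i => (P.coords i).natDegree

theorem eval_ne_zero (t : K) : (fun i => (P.coords i).eval t) ≠ 0 := by
  intro h
  refine Polynomial.not_isUnit_X_sub_C t (P.gcd_eq_one _ fun i => ?_)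
  exact Polynomial.dvd_iff_isRoot.2 (congrFun h i)

theorem coeff_deg_ne_zero : (fun i => (P.coords i).coeff P.deg) ≠ 0 := by
  intro h
  obtain ⟨i, -, hi⟩ := Finset.exists_mem_eq_sup (Finset.univ : Finset (Fin 3))
    Finset.univ_nonempty fun i => (P.coords i).natDegree
  have h0 : P.coords i = 0 := by
    have := congrFun h i
    simp only [deg, hi, Pi.zero_apply] at this
    exact Polynomial.leadingCoeff_eq_zero.1 this
  have hd : P.deg = 0 := by
    simp only [deg, hi, h0, Polynomial.natDegree_zero]
  refine P.eval_ne_zero 0 (funext fun j => ?_)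
  have := congrFun h j
  rw [hd] at this
  simpa [Polynomial.coeff_zero_eq_eval_zero] using this

/-- The point `𝒫(t)` reached at the parameter value `t`. -/
def point (t : K) : ProjPlane K :=
  Projectivization.mk K (fun i => (P.coords i).eval t) (P.eval_ne_zero t)

/-- The limit point `(a_d : b_d : c_d)`. -/
def limitPoint : ProjPlane K :=
  Projectivization.mk K (fun i => (P.coords i).coeff P.deg) P.coeff_deg_ne_zero

/-- The plane curve defined by the parametrization: the Zariski closure of its image. -/
def curve : Set (ProjPlane K) := projZariskiClosure (Set.range P.point)

/-- The image in `K(t)` of the function field of the curve under pullback along `t ↦ 𝒫(t)`: the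
field generated over `K` by the quotients of the homogeneous coordinates. -/
def functionField : IntermediateField K (RatFunc K) :=
  IntermediateField.adjoin K {f | ∃ i j, P.coords j ≠ 0 ∧
    f = algebraMap K[X] (RatFunc K) (P.coords i) / algebraMap K[X] (RatFunc K) (P.coords j)}

/-- The degree `[K(t) : K(C)]` of the rational map `t ↦ 𝒫(t)` onto the curve (with value `0` when
the extension is infinite, that is, when the parametrization is constant). -/
def mapDegree : ℕ := Module.finrank P.functionField (RatFunc K)

/-- The parametrization is proper, i.e. birational onto the curve. -/
def IsProper : Prop := P.mapDegree = 1

/-- The degree of the fibre function `H_L` of the limit point. -/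
def visibleMultiplicity : ℕ :=
  (fibreFunction P.coords P.limitPoint.rep).natDegree

/-- The coordinates `t ^ d * pᵢ(1 / t)` of the reparametrization `𝒰(t) = 𝒫(1 / t)`. -/
def reversedCoords : Fin 3 → K[X] := fun i => (P.coords i).reflect P.deg

/-- The exponent of `t` in the fibre function of the limit point with respect to
`𝒰(t) = 𝒫(1 / t)`. -/
def hiddenMultiplicity : ℕ :=
  (fibreFunction P.reversedCoords P.limitPoint.rep).rootMultiplicity 0

end PlaneParametrization

end

/-!
Let `F` be a defining form of the curve, of degree `n`. The multiplicity of the curve at `x` is the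
order of `F (X + x)` at the origin; as `F` is homogeneous, this is `n - e`, where `e` is the degree
in `T` of `F (X + T x)`. In coordinates whose first frame vector is `x`, `e` is the degree of `F` in
the first variable, that is, the degree of the projection of the curve from `x`. For a proper
parametrization with coordinates `(q₀, q₁, q₂)` in that frame, it equals
`[K(t) : K(q₁/q₂)] = max (deg q₁) (deg q₂) - deg (gcd q₁ q₂) = d - m - deg H`, where `H = gcd q₁ q₂`
is the fibre function of `x` and `m` is the order at `0` of the fibre function of `x` for the
reversed parametrization, which measures how far `q₁` and `q₂` both drop below degree `d`. Hence
`mult x + d = n + deg H + m` for every `x`. At a point off the curve the terms `mult x`, `deg H` and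
`m` vanish, so `n = d` and `mult x = deg H + m`.

For `x = P_L = 𝒫 t₀`, the fibre function is divisible by `X - C t₀`, and the reversed one by `X`.
Both are nonzero because the coordinates of `𝒫` are linearly independent: a proper parametrization
with dependent coordinates has `d ≤ 1`, and the limit point of such a parametrization is reached
only if the parametrization is constant, hence not proper.
-/

open IntermediateField
open scoped Matrix

section Forms

theorem aeval_const_mul_of_isHomogeneous {R A σ : Type*} [CommSemiring R] [CommSemiring A]
    [Algebra R A] {F : MvPolynomial σ R} {n : ℕ} (hF : F.IsHomogeneous n) (c : A) (x : σ → A) :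
    MvPolynomial.aeval (fun i => c * x i) F = c ^ n * MvPolynomial.aeval x F := by
  simp only [MvPolynomial.aeval_def, MvPolynomial.eval₂_eq, Finset.mul_sum]
  refine Finset.sum_congr rfl fun m hm => ?_
  rw [hF.degree_eq_sum_deg_support hm, ← Finset.prod_pow_eq_pow_sum]
  simp only [mul_pow, Finset.prod_mul_distrib]
  ring

theorem exists_isHomogeneous_of_dvd_homogeneousComponent {R σ : Type*} [CommRing R] [IsDomain R]
    {F : MvPolynomial σ R} (h : ∀ k, F ∣ MvPolynomial.homogeneousComponent k F) :
    ∃ n, F.IsHomogeneous n := by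
  by_cases hF : F = 0
  · exact ⟨0, hF ▸ MvPolynomial.isHomogeneous_zero _ _ _⟩
  obtain ⟨k, hk⟩ : ∃ k, MvPolynomial.homogeneousComponent k F ≠ 0 := by
    contrapose! hF
    rw [← MvPolynomial.sum_homogeneousComponent F]
    exact Finset.sum_eq_zero fun k _ => hF k
  have hFk := MvPolynomial.homogeneousComponent_isHomogeneous k F
  obtain ⟨u, hu⟩ := h k
  have hu0 : u ≠ 0 := by rintro rfl; exact hk (by rw [hu, mul_zero])
  have hdeg : k = F.totalDegree + u.totalDegree := by
    rw [← hFk.totalDegree hk, hu, MvPolynomial.totalDegree_mul_of_isDomain hF hu0]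
  have hle : k ≤ F.totalDegree := by
    by_contra! hlt
    exact hk (MvPolynomial.homogeneousComponent_eq_zero _ _ hlt)
  obtain ⟨c, rfl⟩ : ∃ c, u = MvPolynomial.C c :=
    ⟨_, MvPolynomial.totalDegree_eq_zero_iff_eq_C.1 (by lia)⟩
  have hc : c ≠ 0 := by rintro rfl; exact hu0 (map_zero _)
  refine ⟨k, fun m hm => hFk ?_⟩
  rw [hu, mul_comm, MvPolynomial.coeff_C_mul]
  exact mul_ne_zero hc hm

theorem aeval_bind₁_toMvPolynomial {R A m n : Type*} [CommSemiring R] [CommSemiring A]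
    [Algebra R A] [Fintype n] (M : Matrix m n R) (F : MvPolynomial m R)
    (x : n → A) :
    MvPolynomial.aeval x (MvPolynomial.bind₁ M.toMvPolynomial F) =
      MvPolynomial.aeval (M.map (algebraMap R A) *ᵥ x) F := by
  rw [MvPolynomial.aeval_bind₁]
  congr 2
  funext i
  simp [Matrix.toMvPolynomial, Matrix.mulVec, dotProduct, MvPolynomial.aeval_monomial]

theorem bind₁_toMvPolynomial_of_mul_eq_one {R n : Type*} [CommSemiring R] [Fintype n]
    [DecidableEq n] {M N : Matrix n n R} (hMN : M * N = 1) (F : MvPolynomial n R) :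
    MvPolynomial.bind₁ N.toMvPolynomial (MvPolynomial.bind₁ M.toMvPolynomial F) = F := by
  simp [MvPolynomial.bind₁_bind₁, ← Matrix.toMvPolynomial_mul, hMN, Matrix.toMvPolynomial_one]

theorem isHomogeneous_bind₁_toMvPolynomial {R m n : Type*} [CommSemiring R] [Fintype n]
    (M : Matrix m n R) {F : MvPolynomial m R} {d : ℕ} (hF : F.IsHomogeneous d) :
    (MvPolynomial.bind₁ M.toMvPolynomial F).IsHomogeneous d := by
  rw [← one_mul d]
  exact hF.aeval _ M.toMvPolynomial_isHomogeneous

theorem degreeOf_aeval_le {R σ τ : Type*} [CommSemiring R] {F : MvPolynomial σ R}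
    {g : σ → MvPolynomial τ R} {a : σ} {b : τ} (ha : (g a).degreeOf b ≤ 1)
    (hne : ∀ i ≠ a, (g i).degreeOf b = 0) :
    (MvPolynomial.aeval g F).degreeOf b ≤ F.degreeOf a := by
  classical
  rw [MvPolynomial.aeval_def, MvPolynomial.eval₂_eq, MvPolynomial.algebraMap_eq]
  refine (MvPolynomial.degreeOf_sum_le _ _ _).trans (Finset.sup_le fun m hm => ?_)
  refine (MvPolynomial.degreeOf_C_mul_le _ _ _).trans ?_
  calc (∏ i ∈ m.support, g i ^ m i).degreeOf b
      ≤ ∑ i ∈ m.support, (g i ^ m i).degreeOf b := MvPolynomial.degreeOf_prod_le _ _ _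
    _ ≤ ∑ i ∈ m.support, if i = a then m a else 0 := by
        refine Finset.sum_le_sum fun i _ => (MvPolynomial.degreeOf_pow_le _ _ _).trans ?_
        split_ifs with h
        · subst h; exact (Nat.mul_le_mul_left _ ha).trans (mul_one _).le
        · simp [hne i h]
    _ ≤ m a := by rw [Finset.sum_ite_eq']; split_ifs <;> lia
    _ ≤ F.degreeOf a := MvPolynomial.monomial_le_degreeOf a hm

end Forms

section Order

variable {R : Type*} [CommRing R] {N : ℕ}

theorem aeval_eq_eval₂_finSuccEquiv {A : Type*} [CommRing A] [Algebra R A]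
    (F : MvPolynomial (Fin (N + 1)) R) (x : Fin (N + 1) → A) :
    MvPolynomial.aeval x F = (MvPolynomial.finSuccEquiv R N F).eval₂
      (MvPolynomial.aeval (R := R) (x ∘ Fin.succ) : _ →+* A) (x 0) := by
  let φ : (MvPolynomial (Fin N) R)[X] →ₐ[R] A :=
    Polynomial.eval₂AlgHom (MvPolynomial.aeval (x ∘ Fin.succ)) (x 0) fun _ => Commute.all _ _
  suffices MvPolynomial.aeval x = φ.comp (MvPolynomial.finSuccEquiv R N).toAlgHom from
    DFunLike.congr_fun this F
  ext i
  cases i using Fin.cases <;>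
    simp [φ, MvPolynomial.finSuccEquiv_X_zero, MvPolynomial.finSuccEquiv_X_succ]

theorem homogeneousComponent_aeval_cons_one {n : ℕ} {F : MvPolynomial (Fin (N + 1)) R}
    (hF : F.IsHomogeneous n) {j k : ℕ} (hjk : j + k = n) :
    MvPolynomial.homogeneousComponent k
        (MvPolynomial.aeval (Fin.cons 1 MvPolynomial.X : Fin (N + 1) → MvPolynomial (Fin N) R) F) =
      (MvPolynomial.finSuccEquiv R N F).coeff j := by
  have hle : (MvPolynomial.finSuccEquiv R N F).natDegree ≤ n := by
    rw [MvPolynomial.natDegree_finSuccEquiv]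
    exact (MvPolynomial.degreeOf_le_totalDegree _ _).trans hF.totalDegree_le
  have hcomp : (Fin.cons 1 MvPolynomial.X : Fin (N + 1) → MvPolynomial (Fin N) R) ∘ Fin.succ =
      MvPolynomial.X := Fin.cons_comp_succ _ _
  have hcoeff : ∀ i ∈ Finset.range (n + 1), MvPolynomial.homogeneousComponent k
      ((MvPolynomial.finSuccEquiv R N F).coeff i) =
      if i = j then (MvPolynomial.finSuccEquiv R N F).coeff i else 0 := fun i hi => by
    have hi' := Finset.mem_range.1 hi
    rw [MvPolynomial.homogeneousComponent_of_mem
      (hF.finSuccEquiv_coeff_isHomogeneous i (n - i) (by lia))]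
    exact if_congr (by lia) rfl rfl
  rw [aeval_eq_eval₂_finSuccEquiv, hcomp, Polynomial.eval₂_eq_sum_range' _ (Nat.lt_succ_of_le hle),
    map_sum]
  simp only [Fin.cons_zero, one_pow, mul_one, MvPolynomial.aeval_X_left, AlgHom.coe_toRingHom,
    AlgHom.id_apply]
  rw [Finset.sum_congr rfl hcoeff, Finset.sum_ite_eq', if_pos (Finset.mem_range.2 (by lia))]

/-- The form `F (X + T v)`, the Taylor expansion of `F` along the direction `v`. The parameter `T`
is the variable `X 0`, and the `i`-th coordinate of `X` is the variable `X i.succ`. -/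
noncomputable def pencil (F : MvPolynomial (Fin N) R) (v : Fin N → R) :
    MvPolynomial (Fin (N + 1)) R :=
  MvPolynomial.aeval
    (fun i => MvPolynomial.X i.succ + MvPolynomial.C (v i) * MvPolynomial.X 0) F

theorem isHomogeneous_pencil {n : ℕ} {F : MvPolynomial (Fin N) R}
    (hF : F.IsHomogeneous n) (v : Fin N → R) : (pencil F v).IsHomogeneous n := by
  rw [← one_mul n]
  exact hF.aeval _ fun i =>
    (MvPolynomial.isHomogeneous_X _ _).add ((MvPolynomial.isHomogeneous_X _ _).C_mul _)

theorem aeval_cons_pencil {A : Type*} [CommRing A] [Algebra R A]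
    (F : MvPolynomial (Fin N) R) (v : Fin N → R) (a : A) (x : Fin N → A) :
    MvPolynomial.aeval (Fin.cons a x : Fin (N + 1) → A) (pencil F v) =
      MvPolynomial.aeval (fun i => x i + algebraMap R A (v i) * a) F := by
  rw [pencil, ← AlgHom.comp_apply, MvPolynomial.comp_aeval]
  simp

theorem pencil_ne_zero {F : MvPolynomial (Fin N) R} (hF : F ≠ 0) (v : Fin N → R) :
    pencil F v ≠ 0 := by
  contrapose! hF
  simpa [hF] using
    (aeval_cons_pencil F v (0 : MvPolynomial (Fin N) R) MvPolynomial.X).symm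

/-- The lowest homogeneous component of `F (X + v)` is the leading coefficient of `F (X + T v)`
in `T`. -/
theorem orderAt_add_degreeOf_pencil {K : Type*} [Field K] {n : ℕ} {F : MvPolynomial (Fin 3) K}
    (hF : F.IsHomogeneous n) (h0 : F ≠ 0) (x : ProjPlane K) :
    orderAt F x + (pencil F x.rep).degreeOf 0 = n := by
  set S := pencil F x.rep
  have hS : S.IsHomogeneous n := isHomogeneous_pencil hF _
  have hle : S.degreeOf 0 ≤ n :=
    (MvPolynomial.degreeOf_le_totalDegree _ _).trans hS.totalDegree_le
  have hshift := aeval_cons_pencil F x.rep (1 : MvPolynomial (Fin 3) K) MvPolynomial.X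
  simp only [mul_one, MvPolynomial.algebraMap_eq] at hshift
  suffices orderAt F x = n - S.degreeOf 0 by lia
  unfold orderAt
  rw [← hshift]
  refine le_antisymm (Nat.sInf_le ?_) (le_csInf ⟨n - S.degreeOf 0, ?_⟩ fun k hk => ?_)
  iterate 2
    rw [Set.mem_ofPred_eq, homogeneousComponent_aeval_cons_one hS (Nat.add_sub_of_le hle),
      ← MvPolynomial.natDegree_finSuccEquiv]
    simpa using pencil_ne_zero h0 _
  by_contra! hlt
  rw [Set.mem_ofPred_eq, homogeneousComponent_aeval_cons_one hS (Nat.sub_add_cancel (by lia))] at hk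
  refine hk (Polynomial.coeff_eq_zero_of_natDegree_lt ?_)
  rw [MvPolynomial.natDegree_finSuccEquiv]
  lia

theorem degreeOf_zero_sum_C_mul_X_succ [Nontrivial R] (a : Fin N → R) :
    (∑ j, MvPolynomial.C (a j) * MvPolynomial.X j.succ :
      MvPolynomial (Fin (N + 1)) R).degreeOf 0 = 0 := by
  refine Nat.eq_zero_of_le_zero ((MvPolynomial.degreeOf_sum_le _ _ _).trans
    (Finset.sup_le fun j _ => (MvPolynomial.degreeOf_C_mul_le _ _ _).trans_eq ?_))
  exact MvPolynomial.degreeOf_X_of_ne (Fin.succ_ne_zero j).symm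

theorem degreeOf_pencil_col_zero [Nontrivial R] {M M' : Matrix (Fin (N + 1)) (Fin (N + 1)) R}
    (hM : M * M' = 1) (F : MvPolynomial (Fin (N + 1)) R) :
    (pencil F (M.col 0)).degreeOf 0 = (MvPolynomial.bind₁ M.toMvPolynomial F).degreeOf 0 := by
  refine le_antisymm ?_ ?_
  · have hpencil : pencil F (M.col 0) = MvPolynomial.aeval
        (fun i => ∑ j, MvPolynomial.C (M' i j) * MvPolynomial.X j.succ +
          MvPolynomial.C ((1 : Matrix (Fin (N + 1)) (Fin (N + 1)) R) i 0) * MvPolynomial.X 0)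
        (MvPolynomial.bind₁ M.toMvPolynomial F) := by
      conv_lhs => rw [pencil, ← bind₁_toMvPolynomial_of_mul_eq_one hM F, aeval_bind₁_toMvPolynomial]
      congr 2
      funext i
      simp [← mul_eq_one_comm.1 hM, Matrix.mulVec, dotProduct, Matrix.mul_apply, mul_add,
        Finset.sum_add_distrib, Finset.sum_mul, mul_assoc]
    rw [hpencil]
    refine degreeOf_aeval_le ((MvPolynomial.degreeOf_add_le _ _ _).trans (max_le ?_ ?_))
      fun i hi => ?_
    · simp [degreeOf_zero_sum_C_mul_X_succ]
    · exact (MvPolynomial.degreeOf_C_mul_le _ _ _).trans_eq (MvPolynomial.degreeOf_X_self _)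
    · rw [Matrix.one_apply_ne hi, map_zero, zero_mul, add_zero, degreeOf_zero_sum_C_mul_X_succ]
  · have hbind : MvPolynomial.bind₁ M.toMvPolynomial F = MvPolynomial.aeval
        (Fin.cons (MvPolynomial.X 0)
          fun i => ∑ j : Fin N, MvPolynomial.C (M i j.succ) * MvPolynomial.X j.succ)
        (pencil F (M.col 0)) := by
      rw [aeval_cons_pencil, MvPolynomial.bind₁]
      congr 2
      funext i
      simp [Matrix.toMvPolynomial, Fin.sum_univ_succ, MvPolynomial.C_mul_X_eq_monomial, add_comm]
    rw [hbind]
    refine degreeOf_aeval_le (MvPolynomial.degreeOf_X_self _).le fun i hi => ?_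
    obtain ⟨i, rfl⟩ := Fin.exists_succ_eq.2 hi
    rw [Fin.cons_succ, degreeOf_zero_sum_C_mul_X_succ]

end Order

section Relations

variable {K A σ : Type*} [Field K] [CommRing A] [Algebra K A]

/-- `F` is a homogeneous generator of the homogeneous relations over `K` between the elements
`x i`. For the coordinates of a parametrization these are the defining forms of its image, and
restricting to homogeneous relations makes the notion invariant under rescaling `x`. -/
def IsRelationGenerator (F : MvPolynomial σ K) (x : σ → A) : Prop :=
  (∃ n, F.IsHomogeneous n) ∧
    ∀ n (H : MvPolynomial σ K), H.IsHomogeneous n → (MvPolynomial.aeval x H = 0 ↔ F ∣ H)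

theorem IsRelationGenerator.aeval_eq_zero {F : MvPolynomial σ K} {x : σ → A}
    (h : IsRelationGenerator F x) : MvPolynomial.aeval x F = 0 := by
  obtain ⟨n, hn⟩ := h.1
  exact (h.2 n F hn).2 dvd_rfl

theorem isRelationGenerator_const_mul_iff [IsDomain A] {F : MvPolynomial σ K} {x : σ → A} {c : A}
    (hc : c ≠ 0) : IsRelationGenerator F (fun i => c * x i) ↔ IsRelationGenerator F x := by
  refine and_congr_right' (forall₃_congr fun n H hH => ?_)
  rw [aeval_const_mul_of_isHomogeneous hH, mul_eq_zero, or_iff_right (pow_ne_zero n hc)]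

theorem isRelationGenerator_algebraMap_iff {B : Type*} [CommRing B] [Algebra K B] [Algebra A B]
    [IsScalarTower K A B] [FaithfulSMul A B] {F : MvPolynomial σ K} {x : σ → A} :
    IsRelationGenerator F (fun i => algebraMap A B (x i)) ↔ IsRelationGenerator F x := by
  refine and_congr_right' (forall₃_congr fun n H hH => ?_)
  rw [← Function.comp_def, MvPolynomial.aeval_algebraMap_apply,
    map_eq_zero_iff _ (FaithfulSMul.algebraMap_injective A B)]

theorem IsRelationGenerator.bind₁_toMvPolynomial [Fintype σ] [DecidableEq σ] {M N : Matrix σ σ K}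
    (hMN : M * N = 1) {F : MvPolynomial σ K} {x : σ → A} (h : IsRelationGenerator F x) :
    IsRelationGenerator (MvPolynomial.bind₁ M.toMvPolynomial F)
      (N.map (algebraMap K A) *ᵥ x) := by
  obtain ⟨⟨n, hn⟩, hdvd⟩ := h
  refine ⟨⟨n, isHomogeneous_bind₁_toMvPolynomial M hn⟩, fun k H hH => ?_⟩
  rw [← aeval_bind₁_toMvPolynomial, hdvd k _ (isHomogeneous_bind₁_toMvPolynomial N hH)]
  refine ⟨fun hF => ?_, fun hF => ?_⟩
  · simpa only [bind₁_toMvPolynomial_of_mul_eq_one (mul_eq_one_comm.1 hMN)] using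
      map_dvd (MvPolynomial.bind₁ M.toMvPolynomial) hF
  · simpa only [bind₁_toMvPolynomial_of_mul_eq_one hMN] using
      map_dvd (MvPolynomial.bind₁ N.toMvPolynomial) hF

/-- The substitution `X i ↦ T * x i` into `A[T]`, the pullback along the affine cone over `x`: its
kernel consists of the polynomials whose homogeneous components all vanish at `x`. -/
noncomputable def coneHom (K : Type*) [Field K] [Algebra K A] (x : σ → A) :
    MvPolynomial σ K →ₐ[K] A[X] :=
  MvPolynomial.aeval fun i => X * C (x i)

theorem coneHom_of_isHomogeneous {n : ℕ} {H : MvPolynomial σ K} (hH : H.IsHomogeneous n)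
    (x : σ → A) : coneHom K x H = X ^ n * C (MvPolynomial.aeval x H) := by
  rw [coneHom, aeval_const_mul_of_isHomogeneous hH]
  exact congrArg _ (MvPolynomial.aeval_algebraMap_apply A[X] x H)

theorem coeff_coneHom (x : σ → A) (G : MvPolynomial σ K) (k : ℕ) :
    (coneHom K x G).coeff k =
      MvPolynomial.aeval x (MvPolynomial.homogeneousComponent k G) := by
  conv_lhs => rw [← MvPolynomial.sum_homogeneousComponent G, map_sum, Polynomial.finsetSum_coeff]
  rw [Finset.sum_congr rfl fun i _ => by
    rw [coneHom_of_isHomogeneous (MvPolynomial.homogeneousComponent_isHomogeneous i G),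
      Polynomial.coeff_mul_C, Polynomial.coeff_X_pow, ite_mul, one_mul, zero_mul]]
  rw [Finset.sum_ite_eq]
  split_ifs with hk
  · rfl
  · rw [MvPolynomial.homogeneousComponent_eq_zero _ _ (by simpa using hk), map_zero]

theorem coneHom_injective {x : σ → A} (hx : ∀ n (H : MvPolynomial σ K), H.IsHomogeneous n →
    MvPolynomial.aeval x H = 0 → H = 0) : Function.Injective (coneHom K x) := by
  refine (injective_iff_map_eq_zero _).2 fun G hG => ?_
  rw [← MvPolynomial.sum_homogeneousComponent G]
  exact Finset.sum_eq_zero fun k _ => hx k _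
    (MvPolynomial.homogeneousComponent_isHomogeneous k G) (by rw [← coeff_coneHom, hG, coeff_zero])

theorem exists_aeval_eq_zero_iff_dvd {R L : Type*} [CommRing R] [IsDomain R]
    [UniqueFactorizationMonoid R] [Field L] [Algebra R L] [FaithfulSMul R L] (x : L) :
    ∃ f : R[X], ∀ g, aeval x g = 0 ↔ f ∣ g := by
  let I : Ideal R[X] := RingHom.ker (aeval (R := R) x)
  have hI : I.IsPrime := RingHom.ker_isPrime _
  have hmem : ∀ g, g ∈ I ↔ aeval x g = 0 := fun g => RingHom.mem_ker
  by_cases hbot : I = ⊥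
  · exact ⟨0, fun g => by rw [← hmem, hbot, Ideal.mem_bot, zero_dvd_iff]⟩
  obtain ⟨f, hf, hprime⟩ := hI.exists_mem_prime_of_ne_bot hbot
  rw [hmem] at hf
  refine ⟨f, fun g => ⟨fun hg => ?_, fun ⟨q, hq⟩ => by rw [hq, map_mul, hf, zero_mul]⟩⟩
  have hdeg : f.natDegree ≠ 0 := by
    intro h
    obtain ⟨a, rfl⟩ := Polynomial.natDegree_eq_zero.1 h
    rw [aeval_C, map_eq_zero_iff _ (FaithfulSMul.algebraMap_injective R L)] at hf
    exact hprime.ne_zero (by rw [hf, map_zero])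
  have hprim := hprime.irreducible.isPrimitive hdeg
  -- By Gauss's lemma, `f` is associated over the fraction field to the minimal polynomial of `x`.
  let Q := FractionRing R
  let _ : Algebra Q L := FractionRing.liftAlgebra R L
  have : IsScalarTower R Q L := FractionRing.isScalarTower_liftAlgebra R L
  obtain ⟨_⟩ : Nonempty (NormalizedGCDMonoid R) := inferInstance
  have hirr := (hprim.irreducible_iff_irreducible_map_fraction_map (K := Q)).1 hprime.irreducible
  rw [hprim.dvd_iff_fraction_map_dvd_fraction_map (K := Q)]
  have hroot : aeval x (f.map (algebraMap R Q)) = 0 := by rw [aeval_map_algebraMap, hf]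
  have hint : IsIntegral Q x := IsAlgebraic.isIntegral ⟨_, hirr.ne_zero, hroot⟩
  have hdvd := minpoly.dvd Q x (p := g.map (algebraMap R Q)) (by rw [aeval_map_algebraMap, hg])
  exact ((minpoly.irreducible hint).associated_of_dvd hirr
    (minpoly.dvd Q x hroot)).symm.dvd.trans hdvd

theorem exists_eval₂_eq_zero_iff_dvd {R B : Type*} [CommRing R] [IsDomain R]
    [UniqueFactorizationMonoid R] [CommRing B] [IsDomain B] {φ : R →+* B}
    (hφ : Function.Injective φ) (b : B) : ∃ f : R[X], ∀ g, g.eval₂ φ b = 0 ↔ f ∣ g := by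
  let L := FractionRing B
  have hBL : Function.Injective (algebraMap B L) := IsFractionRing.injective B L
  let _ : Algebra R L := ((algebraMap B L).comp φ).toAlgebra
  have : FaithfulSMul R L := (faithfulSMul_iff_algebraMap_injective R L).2 (hBL.comp hφ)
  obtain ⟨f, hf⟩ := exists_aeval_eq_zero_iff_dvd (R := R) (algebraMap B L b)
  refine ⟨f, fun g => ?_⟩
  rw [← hf, ← map_eq_zero_iff _ hBL, Polynomial.hom_eval₂]
  rfl

theorem exists_isRelationGenerator [IsDomain A] {N : ℕ} {x : Fin (N + 1) → A}
    (hx : ∀ n (H : MvPolynomial (Fin N) K), H.IsHomogeneous n →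
      MvPolynomial.aeval (x ∘ Fin.succ) H = 0 → H = 0) :
    ∃ F : MvPolynomial (Fin (N + 1)) K, IsRelationGenerator F x := by
  let e := MvPolynomial.finSuccEquiv K N
  obtain ⟨f, hf⟩ := exists_eval₂_eq_zero_iff_dvd (φ := (coneHom K (x ∘ Fin.succ)).toRingHom)
    (coneHom_injective hx) (X * C (x 0))
  have hdvd : ∀ G, coneHom K x G = 0 ↔ e.symm f ∣ G := fun G => by
    rw [← map_dvd_iff e, e.apply_symm_apply, ← hf, coneHom, aeval_eq_eval₂_finSuccEquiv]
    rfl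
  refine ⟨e.symm f, exists_isHomogeneous_of_dvd_homogeneousComponent fun k => ?_,
    fun n H hH => ?_⟩
  · rw [← hdvd, coneHom_of_isHomogeneous (MvPolynomial.homogeneousComponent_isHomogeneous k _),
      ← coeff_coneHom, (hdvd _).2 dvd_rfl, coeff_zero, map_zero, mul_zero]
  · rw [← hdvd, coneHom_of_isHomogeneous hH, mul_eq_zero, or_iff_right (pow_ne_zero n X_ne_zero),
      C_eq_zero]

end Relations

section Degree

variable {K L : Type*} [Field K] [Field L] [Algebra K L]

theorem eq_zero_of_aeval_transcendental_one_eq_zero {s : L} (hs : Transcendental K s) {n : ℕ}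
    {H : MvPolynomial (Fin 2) K} (hH : H.IsHomogeneous n)
    (h : MvPolynomial.aeval ![s, 1] H = 0) : H = 0 := by
  have hdehom : aeval s (MvPolynomial.aeval ![(X : K[X]), 1] H) = 0 := by
    rw [← h, ← AlgHom.comp_apply, MvPolynomial.comp_aeval]
    congr 2
    ext i
    fin_cases i <;> simp
  rw [← Polynomial.homogenize_eq_of_isHomogeneous hH
    (transcendental_iff.1 hs _ hdehom), Polynomial.homogenize_zero]

open scoped IntermediateField.algebraAdjoinAdjoin in
theorem exists_eval₂_eq_zero_of_isIntegral_adjoin {s z : L}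
    (hs : Transcendental K s) (hz : IsIntegral K⟮s⟯ z) :
    ∃ g : K[X][X], g ≠ 0 ∧ g.natDegree ≤ (minpoly K⟮s⟯ z).natDegree ∧
      g.eval₂ (aeval s : K[X] →ₐ[K] L).toRingHom z = 0 := by
  let A := Algebra.adjoin K {s}
  let e := Polynomial.algEquivOfTranscendental K s hs
  let g' : A[X] := IsLocalization.integerNormalization (nonZeroDivisors A) (minpoly K⟮s⟯ z)
  have hg0 : g' ≠ 0 := by
    rw [Ne, IsFractionRing.integerNormalization_eq_zero_iff]
    exact minpoly.ne_zero hz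
  refine ⟨g'.map e.symm.toRingEquiv.toRingHom, ?_, ?_, ?_⟩
  · rw [Ne, Polynomial.map_eq_zero_iff]
    exacts [hg0, e.symm.injective]
  · refine Polynomial.natDegree_map_le.trans ?_
    exact Polynomial.natDegree_le_natDegree (Polynomial.degree_mono <|
      IsLocalization.integerNormalization_support _ _)
  · have hroot : aeval z g' = 0 :=
      IsLocalization.integerNormalization_aeval_eq_zero _ _ (minpoly.aeval _ _)
    rw [Polynomial.eval₂_map, ← hroot, aeval_def]
    congr 1
    ext a
    obtain ⟨b, rfl⟩ := e.surjective a
    simp [e]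

theorem exists_isHomogeneous_aeval_eq {R : Type*} [CommSemiring R] [Nontrivial R] (g : R[X][X]) :
    ∃ (n : ℕ) (H : MvPolynomial (Fin 3) R), H.IsHomogeneous n ∧ H.degreeOf 0 ≤ g.natDegree ∧
      MvPolynomial.aeval ![X, C X, (1 : R[X][X])] H = g := by
  obtain ⟨D, hD⟩ : ∃ D, ∀ j ∈ g.support, (g.coeff j).natDegree ≤ D :=
    ⟨_, fun j hj => Finset.le_sup (f := fun j => (g.coeff j).natDegree) hj⟩
  set N := g.natDegree + D
  have hN : ∀ j ∈ g.support, j + (N - j) = N ∧ (g.coeff j).natDegree ≤ N - j := fun j hj => by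
    have hle := Polynomial.le_natDegree_of_mem_supp j hj
    have hDj := hD j hj
    lia
  refine ⟨N, ∑ j ∈ g.support, MvPolynomial.X 0 ^ j *
    MvPolynomial.rename Fin.succ ((g.coeff j).homogenize (N - j)),
    MvPolynomial.IsHomogeneous.sum _ _ _ fun j hj => ?_,
    (MvPolynomial.degreeOf_sum_le _ _ _).trans (Finset.sup_le fun j hj => ?_), ?_⟩
  · have hhom := (MvPolynomial.isHomogeneous_X_pow (R := R) (0 : Fin 3) j).mul
      ((Polynomial.isHomogeneous_homogenize (n := N - j)
        (g.coeff j)).rename_isHomogeneous (f := Fin.succ))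
    rwa [(hN j hj).1] at hhom
  · have hX : (MvPolynomial.X 0 ^ j : MvPolynomial (Fin 3) R).degreeOf 0 ≤ j := by
      simp
    have hcoeff : (MvPolynomial.rename Fin.succ
        ((g.coeff j).homogenize (N - j))).degreeOf (0 : Fin 3) = 0 := by
      by_contra hmem
      obtain ⟨i, -, hi⟩ :=
        MvPolynomial.mem_vars_rename _ _ (MvPolynomial.mem_vars_iff_degreeOf_ne_zero.2 hmem)
      exact Fin.succ_ne_zero i hi
    have hle := Polynomial.le_natDegree_of_mem_supp j hj
    exact (MvPolynomial.degreeOf_mul_le _ _ _).trans (by lia)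
  · conv_rhs => rw [g.as_sum_support_C_mul_X_pow]
    rw [map_sum]
    refine Finset.sum_congr rfl fun j hj => ?_
    rw [map_mul, map_pow, MvPolynomial.aeval_X, MvPolynomial.aeval_rename,
      Polynomial.aeval_homogenize_of_eq_one (hN j hj).2 _ (by simp), mul_comm]
    have haeval := Polynomial.aeval_algebraMap_apply R[X][X] (X : R[X]) (g.coeff j)
    rw [aeval_X_left_apply] at haeval
    exact congrArg (· * _) haeval

theorem natDegree_minpoly_le_degreeOf {s z : L} (hs : Transcendental K s) {n : ℕ}
    {H : MvPolynomial (Fin 3) K} (hH : H.IsHomogeneous n) (h0 : H ≠ 0)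
    (h : MvPolynomial.aeval ![z, s, 1] H = 0) :
    (minpoly K⟮s⟯ z).natDegree ≤ H.degreeOf 0 := by
  let e := MvPolynomial.finSuccEquiv K 2
  let φ : MvPolynomial (Fin 2) K →ₐ[K] K⟮s⟯ := MvPolynomial.aeval ![AdjoinSimple.gen K s, 1]
  have hgen : Transcendental K (AdjoinSimple.gen K s) := fun halg =>
    hs (halg.algebraMap (A := L))
  have hlead : (e H).leadingCoeff.IsHomogeneous (n - H.degreeOf 0) := by
    refine hH.finSuccEquiv_coeff_isHomogeneous _ _ ?_
    have hle := (MvPolynomial.degreeOf_le_totalDegree H 0).trans hH.totalDegree_le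
    rw [MvPolynomial.natDegree_finSuccEquiv]
    lia
  have hlead0 : φ (e H).leadingCoeff ≠ 0 := fun hφ => h0 <| by
    simpa using eq_zero_of_aeval_transcendental_one_eq_zero hgen hlead hφ
  have hmap0 : (e H).map φ.toRingHom ≠ 0 := fun hmap => hlead0 <| by
    simpa using congrArg (coeff · (e H).natDegree) hmap
  have hroot : aeval z ((e H).map φ.toRingHom) = 0 := by
    rw [aeval_def, eval₂_map, ← h, aeval_eq_eval₂_finSuccEquiv]
    congr 1
    ext i
    · simp
    · fin_cases i <;> simp [φ]
  calc (minpoly K⟮s⟯ z).natDegree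
      ≤ ((e H).map φ.toRingHom).natDegree :=
        natDegree_le_of_dvd (minpoly.dvd _ _ hroot) hmap0
    _ ≤ (e H).natDegree := natDegree_map_le
    _ = H.degreeOf 0 := MvPolynomial.natDegree_finSuccEquiv H

theorem IsRelationGenerator.ne_zero_and_degreeOf_eq_natDegree_minpoly {s z : L}
    (hs : Transcendental K s) (hz : IsIntegral K⟮s⟯ z) {F : MvPolynomial (Fin 3) K}
    (hF : IsRelationGenerator F ![z, s, 1]) :
    F ≠ 0 ∧ F.degreeOf 0 = (minpoly K⟮s⟯ z).natDegree := by
  obtain ⟨g, hg0, hgdeg, hg⟩ := exists_eval₂_eq_zero_of_isIntegral_adjoin hs hz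
  obtain ⟨n, H, hH, hHdeg, rfl⟩ := exists_isHomogeneous_aeval_eq g
  have hH0 : H ≠ 0 := by
    rintro rfl
    exact hg0 (map_zero _)
  have hHroot : MvPolynomial.aeval ![z, s, 1] H = 0 := by
    let ψ : K[X][X] →ₐ[K] L := eval₂AlgHom (aeval s) z fun _ => Commute.all _ _
    have hψ : ψ (MvPolynomial.aeval ![X, C X, 1] H) = 0 := hg
    rw [← hψ, ← AlgHom.comp_apply, MvPolynomial.comp_aeval]
    congr 2
    ext i
    fin_cases i <;> simp [ψ]
  obtain ⟨Q, rfl⟩ := (hF.2 n H hH).1 hHroot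
  have hF0 := left_ne_zero_of_mul hH0
  obtain ⟨k, hk⟩ := hF.1
  refine ⟨hF0, le_antisymm ?_ (natDegree_minpoly_le_degreeOf hs hk hF0 hF.aeval_eq_zero)⟩
  rw [MvPolynomial.degreeOf_mul_eq hF0 (right_ne_zero_of_mul hH0)] at hHdeg
  lia

theorem div_mul_cancel_vec_three {x : Fin 3 → L} (hx : x 2 ≠ 0) :
    (fun i => x 2 * ![x 0 / x 2, x 1 / x 2, 1] i) = x := by
  ext i
  fin_cases i <;> simp [mul_div_cancel₀, hx]

theorem exists_isRelationGenerator_of_transcendental {x : Fin 3 → L} (hx : x 2 ≠ 0)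
    (hs : Transcendental K (x 1 / x 2)) :
    ∃ F : MvPolynomial (Fin 3) K, IsRelationGenerator F x := by
  obtain ⟨F, hF⟩ := exists_isRelationGenerator (K := K) (x := ![x 0 / x 2, x 1 / x 2, 1])
    fun _ _ => eq_zero_of_aeval_transcendental_one_eq_zero hs
  refine ⟨F, ?_⟩
  rwa [← isRelationGenerator_const_mul_iff hx, div_mul_cancel_vec_three hx] at hF

theorem IsRelationGenerator.ne_zero_and_degreeOf_eq_finrank {x : Fin 3 → L} (hx : x 2 ≠ 0)
    (hs : Transcendental K (x 1 / x 2)) [FiniteDimensional K⟮x 1 / x 2⟯ L]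
    (htop : K⟮x 1 / x 2⟯⟮x 0 / x 2⟯ = ⊤) {F : MvPolynomial (Fin 3) K}
    (hF : IsRelationGenerator F x) :
    F ≠ 0 ∧ F.degreeOf 0 = Module.finrank K⟮x 1 / x 2⟯ L := by
  have hz : IsIntegral K⟮x 1 / x 2⟯ (x 0 / x 2) := .of_finite _ _
  rw [← finrank_top', ← htop, adjoin.finrank hz]
  rw [← div_mul_cancel_vec_three hx, isRelationGenerator_const_mul_iff hx] at hF
  exact hF.ne_zero_and_degreeOf_eq_natDegree_minpoly hs hz

end Degree

section RationalFunctions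

variable {K : Type*} [Field K]

theorem transcendental_div_of_linearIndependent {α β : K[X]} (h : LinearIndependent K ![α, β]) :
    Transcendental K (algebraMap K[X] (RatFunc K) α / algebraMap K[X] (RatFunc K) β) := by
  refine RatFunc.transcendental_of_ne_C _ ?_
  rintro ⟨c, hc⟩
  have hβ : algebraMap K[X] (RatFunc K) β ≠ 0 := by simpa using h.ne_zero 1
  rw [div_eq_iff hβ, ← RatFunc.algebraMap_C, ← map_mul] at hc
  refine (LinearIndependent.pair_iff' (h.ne_zero 1)).1 (LinearIndependent.pair_symm_iff.1 h) c ?_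
  rw [Polynomial.smul_eq_C_mul]
  exact (IsFractionRing.injective K[X] (RatFunc K) hc).symm

theorem finiteDimensional_adjoin_of_transcendental {s : RatFunc K} (hs : Transcendental K s) :
    FiniteDimensional K⟮s⟯ (RatFunc K) := by
  have hC : ¬ ∃ c, s = RatFunc.C c := by
    rintro ⟨c, rfl⟩
    exact hs (isAlgebraic_algebraMap c)
  have : FiniteDimensional K⟮s⟯ K⟮s⟯⟮(RatFunc.X : RatFunc K)⟯ :=
    adjoin.finiteDimensional
      (isAlgebraic_iff_isIntegral.1 (RatFunc.isAlgebraic_adjoin_simple_X s hC))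
  exact (RatFunc.IntermediateField.adjoinXEquiv K⟮s⟯).toLinearEquiv.finiteDimensional

theorem finrank_adjoin_div_add_natDegree {α β g : K[X]} (hβ : β ≠ 0)
    (hg : ∀ h, h ∣ g ↔ h ∣ α ∧ h ∣ β) :
    Module.finrank K⟮algebraMap K[X] (RatFunc K) α / algebraMap K[X] (RatFunc K) β⟯ (RatFunc K) +
      g.natDegree = max α.natDegree β.natDegree := by
  classical
  have hassoc : Associated g (gcd α β) := associated_of_dvd_dvd
    (dvd_gcd ((hg g).1 dvd_rfl).1 ((hg g).1 dvd_rfl).2)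
    ((hg _).2 ⟨gcd_dvd_left α β, gcd_dvd_right α β⟩)
  have hlead : (β / gcd α β).leadingCoeff⁻¹ ≠ 0 :=
    inv_ne_zero (Polynomial.leadingCoeff_ne_zero.2 (right_div_gcd_ne_zero hβ))
  have hdiv : ∀ f, gcd α β ∣ f → (f / gcd α β).natDegree = f.natDegree - g.natDegree := by
    intro f hf
    have hgcd : gcd α β ≠ 0 := fun h => hβ ((gcd_eq_zero_iff α β).1 h).2
    rcases eq_or_ne f 0 with rfl | hf0
    · simp
    have hmul : gcd α β * (f / gcd α β) = f := EuclideanDomain.mul_div_cancel' hgcd hf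
    conv_rhs => rw [← hmul]
    rw [natDegree_mul hgcd (right_ne_zero_of_mul (hmul.symm ▸ hf0)),
      natDegree_eq_of_degree_eq (degree_eq_degree_of_associated hassoc), Nat.add_sub_cancel_left]
  have hle : g.natDegree ≤ β.natDegree := natDegree_le_of_dvd ((hg g).1 dvd_rfl).2 hβ
  rw [RatFunc.finrank_eq_max_natDegree, RatFunc.num_div, RatFunc.denom_div α hβ,
    natDegree_C_mul hlead, natDegree_C_mul hlead, hdiv α (gcd_dvd_left α β),
    hdiv β (gcd_dvd_right α β)]
  lia

theorem X_pow_dvd_reflect_iff {R : Type*} [CommSemiring R] {f : R[X]} {d k : ℕ} (hf : f ≠ 0)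
    (hd : f.natDegree ≤ d) :
    X ^ k ∣ f.reflect d ↔ k + f.natDegree ≤ d := by
  rw [Polynomial.X_pow_dvd_iff]
  refine ⟨fun h => ?_, fun h i hi => ?_⟩
  · by_contra! hlt
    have hcoeff := h (d - f.natDegree) (by lia)
    rw [Polynomial.coeff_reflect, Polynomial.revAt_le (by lia), Nat.sub_sub_self hd] at hcoeff
    exact hf (Polynomial.leadingCoeff_eq_zero.1 hcoeff)
  · rw [Polynomial.coeff_reflect, Polynomial.revAt_le (by lia)]
    exact Polynomial.coeff_eq_zero_of_natDegree_lt (by lia)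

end RationalFunctions

section Frames

theorem exists_mul_eq_one_and_col_eq {K ι : Type*} [Field K] [Fintype ι] [DecidableEq ι] (i : ι)
    {v : ι → K} (hv : v ≠ 0) : ∃ M N : Matrix ι ι K, M * N = 1 ∧ M.col i = v := by
  have he : (Pi.single i 1 : ι → K) ≠ 0 := by simp
  obtain ⟨g, hg⟩ := Submodule.exists_linearEquiv_restrict_eq
    ((LinearEquiv.toSpanNonzeroSingleton K (ι → K) _ he).symm ≪≫ₗ
      LinearEquiv.toSpanNonzeroSingleton K (ι → K) v hv)
  refine ⟨LinearMap.toMatrix' g, LinearMap.toMatrix' g.symm, ?_, ?_⟩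
  · rw [← LinearMap.toMatrix'_comp, LinearEquiv.comp_symm, LinearMap.toMatrix'_id]
  · rw [← Matrix.mulVec_single_one, LinearMap.toMatrix'_mulVec]
    have hgi := hg (LinearEquiv.toSpanNonzeroSingleton K (ι → K) _ he 1)
    rw [LinearEquiv.trans_apply, LinearEquiv.symm_apply_apply] at hgi
    simpa using hgi.symm

variable {K ι : Type*} [Field K] [Fintype ι]

/-- The coordinates of the polynomial vector `p` in the frame whose dual basis consists of the rows
of `N`; if `M * N = 1`, that frame consists of the columns of `M`. -/
noncomputable def frameCoords (N : Matrix ι ι K) (p : ι → K[X]) : ι → K[X] :=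
  N.map C *ᵥ p

theorem frameCoords_frameCoords_of_mul_eq_one [DecidableEq ι] {M N : Matrix ι ι K}
    (hMN : M * N = 1) (p : ι → K[X]) : frameCoords M (frameCoords N p) = p := by
  rw [frameCoords, frameCoords, Matrix.mulVec_mulVec, ← Matrix.map_mul, hMN,
    Matrix.map_one _ (map_zero C) (map_one C), Matrix.one_mulVec]

theorem linearIndependent_frameCoords [DecidableEq ι] {M N : Matrix ι ι K} (hMN : M * N = 1)
    {p : ι → K[X]} (hp : LinearIndependent K p) : LinearIndependent K (frameCoords N p) := by
  rw [Fintype.linearIndependent_iff] at hp ⊢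
  intro a ha
  have hcomb : ∑ k, (a ᵥ* N) k • p k = 0 := by
    rw [← ha]
    simp only [frameCoords, Matrix.mulVec, Matrix.vecMul, dotProduct, Matrix.map_apply,
      Finset.smul_sum, Finset.sum_smul]
    rw [Finset.sum_comm]
    simp only [Polynomial.smul_eq_C_mul, map_mul, mul_assoc]
  have hvec : a ᵥ* N = 0 := funext (hp _ hcomb)
  have ha0 : a = 0 := calc
    a = a ᵥ* N ᵥ* M := by
      rw [Matrix.vecMul_vecMul, mul_eq_one_comm.1 hMN, Matrix.vecMul_one]
    _ = 0 := by rw [hvec, Matrix.zero_vecMul]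
  exact congrFun ha0

theorem natDegree_frameCoords_le {p : ι → K[X]} {d : ℕ} (hp : ∀ i, (p i).natDegree ≤ d)
    (N : Matrix ι ι K) (j : ι) : (frameCoords N p j).natDegree ≤ d :=
  Polynomial.natDegree_sum_le_of_forall_le _ _ fun k _ =>
    (Polynomial.natDegree_C_mul_le _ _).trans (hp k)

theorem frameCoords_reflect (N : Matrix ι ι K) (p : ι → K[X]) (d : ℕ) (j : ι) :
    frameCoords N (fun i => (p i).reflect d) j = (frameCoords N p j).reflect d := by
  ext k
  simp [frameCoords, Matrix.mulVec, dotProduct, Polynomial.finsetSum_coeff,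
    Polynomial.coeff_reflect]

theorem frameCoords_minor (N : Matrix ι ι K) (p : ι → K[X]) (v : ι → K) (i j : ι) :
    C ((N *ᵥ v) i) * frameCoords N p j - C ((N *ᵥ v) j) * frameCoords N p i =
      ∑ k, ∑ l, C (N i k * N j l) * (C (v k) * p l - C (v l) * p k) := by
  simp only [mul_sub, Finset.sum_sub_distrib, frameCoords, Matrix.mulVec, dotProduct, map_sum,
    Matrix.map_apply, Finset.sum_mul_sum, map_mul]
  refine congrArg₂ (· - ·) ?_ ?_
  · exact Finset.sum_congr rfl fun k _ => Finset.sum_congr rfl fun l _ => by ring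
  · rw [Finset.sum_comm]
    exact Finset.sum_congr rfl fun k _ => Finset.sum_congr rfl fun l _ => by ring

theorem dvd_fibreFunction_iff {p : Fin 3 → K[X]} {v : Fin 3 → K} {h : K[X]} :
    h ∣ fibreFunction p v ↔ ∀ i j, h ∣ C (v i) * p j - C (v j) * p i := by
  classical
  refine ⟨fun hdvd => ?_, fun hdvd => EuclideanDomain.dvd_gcd (hdvd 0 2)
    (EuclideanDomain.dvd_gcd (hdvd 1 2) (hdvd 0 1))⟩
  have h02 := hdvd.trans (EuclideanDomain.gcd_dvd_left _ _)
  have hgcd := hdvd.trans (EuclideanDomain.gcd_dvd_right _ _)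
  have h12 := hgcd.trans (EuclideanDomain.gcd_dvd_left _ _)
  have h01 := hgcd.trans (EuclideanDomain.gcd_dvd_right _ _)
  have hneg (i j : Fin 3) (hij : h ∣ C (v i) * p j - C (v j) * p i) :
      h ∣ C (v j) * p i - C (v i) * p j := by
    rwa [← dvd_neg, neg_sub]
  rw [Fin.forall_fin_succ]
  simp only [Fin.forall_fin_succ, Fin.forall_fin_zero, sub_self, dvd_zero]
  exact ⟨⟨trivial, h01, h02, trivial⟩, ⟨hneg _ _ h01, trivial, h12, trivial⟩,
    ⟨hneg _ _ h02, hneg _ _ h12, trivial, trivial⟩, trivial⟩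

theorem fibreFunction_dvd_fibreFunction_frameCoords (N : Matrix (Fin 3) (Fin 3) K)
    (p : Fin 3 → K[X]) (v : Fin 3 → K) :
    fibreFunction p v ∣ fibreFunction (frameCoords N p) (N *ᵥ v) := by
  refine dvd_fibreFunction_iff.2 fun i j => ?_
  rw [frameCoords_minor]
  exact Finset.dvd_sum fun k _ => Finset.dvd_sum fun l _ =>
    (dvd_fibreFunction_iff.1 dvd_rfl k l).mul_left _

theorem dvd_fibreFunction_single_zero_iff {q : Fin 3 → K[X]} {h : K[X]} :
    h ∣ fibreFunction q (Pi.single 0 1) ↔ h ∣ q 1 ∧ h ∣ q 2 := by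
  simp [dvd_fibreFunction_iff, Fin.forall_fin_succ]

theorem dvd_fibreFunction_col_zero_iff {M N : Matrix (Fin 3) (Fin 3) K} (hMN : M * N = 1)
    {p : Fin 3 → K[X]} {h : K[X]} :
    h ∣ fibreFunction p (M.col 0) ↔ h ∣ frameCoords N p 1 ∧ h ∣ frameCoords N p 2 := by
  have hcol : M *ᵥ Pi.single 0 1 = M.col 0 := Matrix.mulVec_single_one M 0
  have hsingle : N *ᵥ M.col 0 = Pi.single 0 1 := by
    rw [← hcol, Matrix.mulVec_mulVec, mul_eq_one_comm.1 hMN, Matrix.one_mulVec]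
  rw [← dvd_fibreFunction_single_zero_iff]
  refine ⟨fun hdvd => hdvd.trans ?_, fun hdvd => hdvd.trans ?_⟩
  · simpa only [hsingle] using fibreFunction_dvd_fibreFunction_frameCoords N p (M.col 0)
  · simpa only [frameCoords_frameCoords_of_mul_eq_one hMN, hcol] using
      fibreFunction_dvd_fibreFunction_frameCoords M (frameCoords N p) (Pi.single 0 1)

theorem fibreFunction_ne_zero {p : Fin 3 → K[X]} (hp : LinearIndependent K p) {v : Fin 3 → K}
    (hv : v ≠ 0) : fibreFunction p v ≠ 0 := by
  obtain ⟨M, N, hMN, rfl⟩ := exists_mul_eq_one_and_col_eq 0 hv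
  intro h
  have hdvd := (dvd_fibreFunction_col_zero_iff hMN).1 (zero_dvd_iff.2 h)
  exact (linearIndependent_frameCoords hMN hp).ne_zero 1 (zero_dvd_iff.1 hdvd.1)

end Frames

section Points

variable {K : Type*} [Field K]

theorem vanishesAt_mk_iff {F : MvPolynomial (Fin 3) K} {n : ℕ} (hF : F.IsHomogeneous n)
    {v : Fin 3 → K} (hv : v ≠ 0) :
    VanishesAt F (Projectivization.mk K v hv) ↔ MvPolynomial.eval v F = 0 := by
  obtain ⟨a, ha⟩ := Projectivization.exists_smul_eq_mk_rep K v hv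
  have hscale : MvPolynomial.eval (fun i => (a : K) * v i) F =
      (a : K) ^ n * MvPolynomial.eval v F := by
    simpa only [MvPolynomial.aeval_eq_eval] using aeval_const_mul_of_isHomogeneous hF (a : K) v
  rw [VanishesAt, ← ha, show (a • v : Fin 3 → K) = fun i => (a : K) * v i from rfl, hscale,
    mul_eq_zero, or_iff_right (pow_ne_zero _ a.ne_zero)]

theorem exists_not_vanishesAt [Infinite K] {F : MvPolynomial (Fin 3) K} {n : ℕ}
    (hF : F.IsHomogeneous n) (h0 : F ≠ 0) : ∃ x : ProjPlane K, ¬ VanishesAt F x := by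
  have hne : F * MvPolynomial.X 0 ≠ 0 := mul_ne_zero h0 (MvPolynomial.X_ne_zero 0)
  obtain ⟨w, hw⟩ : ∃ w, MvPolynomial.eval w (F * MvPolynomial.X 0) ≠ 0 := by
    contrapose! hne
    exact MvPolynomial.funext fun w => by rw [hne w, map_zero]
  rw [map_mul, MvPolynomial.eval_X] at hw
  have hw0 : w ≠ 0 := fun h => right_ne_zero_of_mul hw (congrFun h 0)
  exact ⟨Projectivization.mk K w hw0,
    (vanishesAt_mk_iff hF hw0).not.2 (left_ne_zero_of_mul hw)⟩

theorem orderAt_eq_zero_of_not_vanishesAt {F : MvPolynomial (Fin 3) K} {x : ProjPlane K}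
    (h : ¬ VanishesAt F x) : orderAt F x = 0 := by
  have hcoeff : MvPolynomial.constantCoeff (MvPolynomial.aeval
      (fun i => (MvPolynomial.X i + MvPolynomial.C (x.rep i) : MvPolynomial (Fin 3) K)) F) =
      MvPolynomial.eval x.rep F := by
    rw [MvPolynomial.map_aeval, MvPolynomial.eval]
    congr 2
    · ext
      simp
    · funext i
      simp
  refine Nat.sInf_eq_zero.2 (.inl ?_)
  rwa [Set.mem_ofPred_eq, MvPolynomial.homogeneousComponent_zero, ← MvPolynomial.constantCoeff_eq,
    hcoeff, Ne, MvPolynomial.C_eq_zero]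

theorem dvd_pow_mul_of_dvd_fibreFunction {p : Fin 3 → K[X]} {w : Fin 3 → K} {h : K[X]}
    (hh : h ∣ fibreFunction p w) {F : MvPolynomial (Fin 3) K} {n : ℕ} (hF : F.IsHomogeneous n)
    (hp : MvPolynomial.aeval p F = 0) (j : Fin 3) :
    h ∣ p j ^ n * C (MvPolynomial.eval w F) := by
  have hmk (i : Fin 3) : Ideal.Quotient.mkₐ K (Ideal.span {h}) (p j * C (w i)) =
      Ideal.Quotient.mkₐ K (Ideal.span {h}) (C (w j) * p i) := by
    refine Ideal.Quotient.eq.2 (Ideal.mem_span_singleton.2 ?_)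
    rw [mul_comm]
    exact dvd_fibreFunction_iff.1 hh i j
  have haeval : C (MvPolynomial.eval w F) = MvPolynomial.aeval (fun i => C (w i)) F :=
    (MvPolynomial.aeval_algebraMap_apply K[X] w F).symm
  rw [haeval, ← aeval_const_mul_of_isHomogeneous hF, ← Ideal.mem_span_singleton,
    ← Ideal.Quotient.eq_zero_iff_mem, ← Ideal.Quotient.mkₐ_eq_mk K, MvPolynomial.comp_aeval_apply]
  simp only [hmk]
  rw [← MvPolynomial.comp_aeval_apply, aeval_const_mul_of_isHomogeneous hF, hp, mul_zero, map_zero]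

theorem X_sub_C_dvd_fibreFunction {p : Fin 3 → K[X]} {t : K} (a : K) :
    X - C t ∣ fibreFunction p fun i => a * (p i).eval t := by
  refine dvd_fibreFunction_iff.2 fun i j => dvd_iff_isRoot.2 ?_
  simp only [IsRoot.def, eval_sub, eval_mul, eval_C]
  ring

theorem dvd_of_prime_of_dvd_fibreFunction {p : Fin 3 → K[X]} {x : ProjPlane K} {h : K[X]}
    (hprime : Prime h) (hh : h ∣ fibreFunction p x.rep) {F : MvPolynomial (Fin 3) K} {n : ℕ}
    (hF : F.IsHomogeneous n) (hp : MvPolynomial.aeval p F = 0) (hx : ¬ VanishesAt F x)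
    (j : Fin 3) : h ∣ p j := by
  have hunit : IsUnit (C (MvPolynomial.eval x.rep F)) := isUnit_C.2 (isUnit_iff_ne_zero.2 hx)
  exact hprime.dvd_of_dvd_pow
    (hunit.dvd_mul_right.1 (dvd_pow_mul_of_dvd_fibreFunction hh hF hp j))

end Points

namespace PlaneParametrization

variable {K : Type*} [Field K] {P : PlaneParametrization K}

section ProjectionDegree

theorem IsProper.eq_top_of_div_mem (hP : P.IsProper) {E : IntermediateField K (RatFunc K)}
    {z : RatFunc K} (hz : z ≠ 0) (h : ∀ i, algebraMap K[X] (RatFunc K) (P.coords i) / z ∈ E) :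
    E = ⊤ := by
  have htop : P.functionField = ⊤ := finrank_eq_one_iff_eq_top.1 hP
  rw [eq_top_iff, ← htop, functionField, adjoin_le_iff]
  rintro _ ⟨i, j, -, rfl⟩
  rw [← div_div_div_cancel_right₀ hz]
  exact E.div_mem (h i) (h j)

theorem coords_eq_sum_frameCoords {M N : Matrix (Fin 3) (Fin 3) K} (hMN : M * N = 1) (i : Fin 3) :
    P.coords i = ∑ j, C (M i j) * frameCoords N P.coords j := by
  conv_lhs => rw [← frameCoords_frameCoords_of_mul_eq_one hMN P.coords]
  rfl

theorem natDegree_coords_le (P : PlaneParametrization K) (i : Fin 3) :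
    (P.coords i).natDegree ≤ P.deg :=
  Finset.le_sup (f := fun i => (P.coords i).natDegree) (Finset.mem_univ i)

theorem rootMultiplicity_fibreFunction_reversedCoords {M N : Matrix (Fin 3) (Fin 3) K}
    (hMN : M * N = 1) (h1 : frameCoords N P.coords 1 ≠ 0) (h2 : frameCoords N P.coords 2 ≠ 0) :
    max (frameCoords N P.coords 1).natDegree (frameCoords N P.coords 2).natDegree +
      (fibreFunction P.reversedCoords (M.col 0)).rootMultiplicity 0 = P.deg := by
  have hdvd (h : K[X]) : h ∣ fibreFunction P.reversedCoords (M.col 0) ↔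
      h ∣ (frameCoords N P.coords 1).reflect P.deg ∧
        h ∣ (frameCoords N P.coords 2).reflect P.deg := by
    rw [dvd_fibreFunction_col_zero_iff hMN, ← frameCoords_reflect, ← frameCoords_reflect]
    rfl
  have hne : fibreFunction P.reversedCoords (M.col 0) ≠ 0 := fun h =>
    h1 (reflect_eq_zero_iff.1 (zero_dvd_iff.1 ((hdvd 0).1 (zero_dvd_iff.2 h)).1))
  have hd := natDegree_frameCoords_le P.natDegree_coords_le N
  have hle (k : ℕ) : k ≤ (fibreFunction P.reversedCoords (M.col 0)).rootMultiplicity 0 ↔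
      k + (frameCoords N P.coords 1).natDegree ≤ P.deg ∧
        k + (frameCoords N P.coords 2).natDegree ≤ P.deg := by
    rw [le_rootMultiplicity_iff hne, map_zero, sub_zero, hdvd, X_pow_dvd_reflect_iff h1 (hd 1),
      X_pow_dvd_reflect_iff h2 (hd 2)]
  have hub := (hle _).1 le_rfl
  have hlb := (hle (P.deg - max (frameCoords N P.coords 1).natDegree
    (frameCoords N P.coords 2).natDegree)).2 (by grind)
  lia

/-- The rational function `q j / q 2`, where `q` are the coordinates of the parametrization in the
frame `N`: an affine coordinate of the curve, pulled back along `t ↦ 𝒫(t)`. -/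
noncomputable def affineCoord (P : PlaneParametrization K) (N : Matrix (Fin 3) (Fin 3) K)
    (j : Fin 3) : RatFunc K :=
  algebraMap K[X] (RatFunc K) (frameCoords N P.coords j) /
    algebraMap K[X] (RatFunc K) (frameCoords N P.coords 2)

variable {M N : Matrix (Fin 3) (Fin 3) K}

theorem finrank_add_natDegree_add_rootMultiplicity (hMN : M * N = 1)
    (hP : LinearIndependent K P.coords) :
    Module.finrank K⟮P.affineCoord N 1⟯ (RatFunc K) +
      (fibreFunction P.coords (M.col 0)).natDegree +
      (fibreFunction P.reversedCoords (M.col 0)).rootMultiplicity 0 = P.deg := by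
  have hq := linearIndependent_frameCoords hMN hP
  rw [affineCoord, finrank_adjoin_div_add_natDegree (hq.ne_zero 2) fun _ =>
    dvd_fibreFunction_col_zero_iff hMN,
    rootMultiplicity_fibreFunction_reversedCoords hMN (hq.ne_zero 1) (hq.ne_zero 2)]

theorem algebraMap_frameCoords_ne_zero (hMN : M * N = 1) (hP : LinearIndependent K P.coords)
    (j : Fin 3) : algebraMap K[X] (RatFunc K) (frameCoords N P.coords j) ≠ 0 :=
  (map_ne_zero_iff _ (IsFractionRing.injective K[X] (RatFunc K))).2
    ((linearIndependent_frameCoords hMN hP).ne_zero j)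

theorem transcendental_affineCoord_one (hMN : M * N = 1) (hP : LinearIndependent K P.coords) :
    Transcendental K (P.affineCoord N 1) := by
  refine transcendental_div_of_linearIndependent ?_
  convert (linearIndependent_frameCoords hMN hP).comp ![1, 2] (by decide) using 1
  ext i
  fin_cases i <;> rfl

theorem exists_isRelationGenerator_coords (hP : LinearIndependent K P.coords) :
    ∃ F : MvPolynomial (Fin 3) K, IsRelationGenerator F P.coords := by
  have hone : (1 : Matrix (Fin 3) (Fin 3) K) * 1 = 1 := one_mul 1
  have hframe : frameCoords 1 P.coords = P.coords := by
    rw [frameCoords, Matrix.map_one _ (map_zero C) (map_one C), Matrix.one_mulVec]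
  have hx := algebraMap_frameCoords_ne_zero hone hP 2
  have hs := transcendental_affineCoord_one hone hP
  simp only [affineCoord, hframe] at hx hs
  obtain ⟨F, hF⟩ := exists_isRelationGenerator_of_transcendental
    (x := fun i => algebraMap K[X] (RatFunc K) (P.coords i)) hx hs
  exact ⟨F, isRelationGenerator_algebraMap_iff.1 hF⟩

theorem coords_div_eq_sum_affineCoord (hMN : M * N = 1) (i : Fin 3) :
    algebraMap K[X] (RatFunc K) (P.coords i) /
        algebraMap K[X] (RatFunc K) (frameCoords N P.coords 2) =
      ∑ j, algebraMap K (RatFunc K) (M i j) * P.affineCoord N j := by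
  simp only [coords_eq_sum_frameCoords hMN i, map_sum, map_mul, Finset.sum_div, mul_div_assoc,
    affineCoord, RatFunc.algebraMap_C, RatFunc.algebraMap_eq_C]

theorem IsProper.adjoin_affineCoord_eq_top (hP : P.IsProper) (hMN : M * N = 1)
    (hz : algebraMap K[X] (RatFunc K) (frameCoords N P.coords 2) ≠ 0) :
    K⟮P.affineCoord N 1⟯⟮P.affineCoord N 0⟯ = ⊤ := by
  rw [← restrictScalars_eq_top_iff (K := K), adjoin_simple_adjoin_simple]
  refine hP.eq_top_of_div_mem hz fun i => ?_
  have h0 : P.affineCoord N 0 ∈ K⟮P.affineCoord N 1, P.affineCoord N 0⟯ :=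
    subset_adjoin _ _ (by simp)
  have h1 : P.affineCoord N 1 ∈ K⟮P.affineCoord N 1, P.affineCoord N 0⟯ :=
    subset_adjoin _ _ (by simp)
  have h2 : P.affineCoord N 2 ∈ K⟮P.affineCoord N 1, P.affineCoord N 0⟯ := by
    rw [show P.affineCoord N 2 = 1 from div_self hz]
    exact one_mem _
  rw [coords_div_eq_sum_affineCoord hMN]
  refine sum_mem fun j _ => mul_mem (IntermediateField.algebraMap_mem _ _) ?_
  fin_cases j
  exacts [h0, h1, h2]

theorem IsProper.ne_zero_and_degreeOf_bind₁_eq_finrank (hP : P.IsProper)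
    (hLI : LinearIndependent K P.coords) (hMN : M * N = 1) {F : MvPolynomial (Fin 3) K}
    (hF : IsRelationGenerator F P.coords) :
    F ≠ 0 ∧ (MvPolynomial.bind₁ M.toMvPolynomial F).degreeOf 0 =
      Module.finrank K⟮P.affineCoord N 1⟯ (RatFunc K) := by
  have hz := algebraMap_frameCoords_ne_zero hMN hLI 2
  have hs := transcendental_affineCoord_one hMN hLI
  have : FiniteDimensional K⟮algebraMap K[X] (RatFunc K) (frameCoords N P.coords 1) /
      algebraMap K[X] (RatFunc K) (frameCoords N P.coords 2)⟯ (RatFunc K) :=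
    finiteDimensional_adjoin_of_transcendental hs
  have hG : IsRelationGenerator (MvPolynomial.bind₁ M.toMvPolynomial F) (frameCoords N P.coords) :=
    hF.bind₁_toMvPolynomial hMN
  obtain ⟨hne, hdeg⟩ := IsRelationGenerator.ne_zero_and_degreeOf_eq_finrank
    (x := fun i => algebraMap K[X] (RatFunc K) (frameCoords N P.coords i)) hz hs
    (hP.adjoin_affineCoord_eq_top hMN hz) (isRelationGenerator_algebraMap_iff.2 hG)
  exact ⟨fun h => hne (by rw [h, map_zero]), hdeg⟩

end ProjectionDegree

section Curve

theorem eval_aeval_eq_eval {q : Fin 3 → K[X]} (F : MvPolynomial (Fin 3) K) (t : K) :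
    (MvPolynomial.aeval q F).eval t = MvPolynomial.eval (fun i => (q i).eval t) F :=
  MvPolynomial.comp_aeval_apply q (Polynomial.aeval t : K[X] →ₐ[K] K) F

theorem vanishesAt_point_iff {F : MvPolynomial (Fin 3) K} {n : ℕ} (hF : F.IsHomogeneous n)
    (t : K) : VanishesAt F (P.point t) ↔ (MvPolynomial.aeval P.coords F).eval t = 0 := by
  rw [point, vanishesAt_mk_iff hF, eval_aeval_eq_eval]

variable [Infinite K]

theorem mem_vanishingForms_curve_iff {F : MvPolynomial (Fin 3) K} :
    F ∈ vanishingForms P.curve ↔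
      (∃ n, F.IsHomogeneous n) ∧ MvPolynomial.aeval P.coords F = 0 := by
  refine and_congr_right ?_
  rintro ⟨n, hn⟩
  refine ⟨fun h => Polynomial.funext fun t => ?_, fun h x hx => hx F ⟨⟨n, hn⟩, ?_⟩⟩
  · rw [eval_zero, ← vanishesAt_point_iff hn]
    exact h _ fun G hG => hG.2 _ ⟨t, rfl⟩
  · rintro _ ⟨t, rfl⟩
    rw [vanishesAt_point_iff hn, h, eval_zero]

theorem isDefiningForm_curve_iff {F : MvPolynomial (Fin 3) K} :
    IsDefiningForm P.curve F ↔ IsRelationGenerator F P.coords := by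
  refine and_congr_right fun hF => ⟨fun hspan n H hH => ?_, fun hdvd => le_antisymm ?_ ?_⟩
  · have hker : homogeneousIdeal P.curve ≤ RingHom.ker (MvPolynomial.aeval (R := K) P.coords) :=
      Ideal.span_le.2 fun G hG => (mem_vanishingForms_curve_iff.1 hG).2
    rw [← Ideal.mem_span_singleton, hspan]
    exact ⟨fun h => Ideal.subset_span (mem_vanishingForms_curve_iff.2 ⟨⟨n, hH⟩, h⟩),
      fun h => hker h⟩
  · obtain ⟨n, hn⟩ := hF
    exact (Ideal.span_singleton_le_iff_mem _).2 (Ideal.subset_span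
      (mem_vanishingForms_curve_iff.2 ⟨⟨n, hn⟩, (hdvd n F hn).2 dvd_rfl⟩))
  · refine Ideal.span_le.2 fun H hH => Ideal.mem_span_singleton.2 ?_
    obtain ⟨⟨n, hn⟩, h0⟩ := mem_vanishingForms_curve_iff.1 hH
    exact (hdvd n H hn).1 h0

end Curve

section DegreeOfCurve

theorem eval_reversedCoords {t : K} (ht : t ≠ 0) (i : Fin 3) :
    (P.reversedCoords i).eval t = t ^ P.deg * (P.coords i).eval t⁻¹ := by
  let _ : Invertible t⁻¹ := invertibleOfNonzero (inv_ne_zero ht)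
  have h := eval₂_reflect_mul_pow (RingHom.id K) t⁻¹ P.deg (P.coords i) (P.natDegree_coords_le i)
  rw [invOf_eq_inv, inv_inv, eval₂_id, eval₂_id, inv_pow] at h
  rw [reversedCoords, ← h]
  field_simp

theorem eval_zero_reversedCoords (i : Fin 3) :
    (P.reversedCoords i).eval 0 = (P.coords i).coeff P.deg := by
  rw [reversedCoords, ← coeff_zero_eq_eval_zero, coeff_reflect, revAt_le (Nat.zero_le _),
    Nat.sub_zero]

variable {F : MvPolynomial (Fin 3) K} {n : ℕ}

theorem aeval_reversedCoords_eq_zero [Infinite K] (hF : F.IsHomogeneous n)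
    (h : MvPolynomial.aeval P.coords F = 0) : MvPolynomial.aeval P.reversedCoords F = 0 := by
  refine (mul_eq_zero.1 (Polynomial.funext fun t => ?_)).resolve_right X_ne_zero
  rw [eval_mul, eval_X, eval_zero]
  rcases eq_or_ne t 0 with rfl | ht
  · rw [mul_zero]
  have heval : MvPolynomial.eval (fun i => t ^ P.deg * (P.coords i).eval t⁻¹) F =
      (t ^ P.deg) ^ n * MvPolynomial.eval (fun i => (P.coords i).eval t⁻¹) F :=
    aeval_const_mul_of_isHomogeneous hF (t ^ P.deg) fun i => (P.coords i).eval t⁻¹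
  rw [eval_aeval_eq_eval, funext (eval_reversedCoords ht), heval, ← eval_aeval_eq_eval, h,
    eval_zero, mul_zero, zero_mul]

theorem natDegree_fibreFunction_eq_zero (hF : F.IsHomogeneous n)
    (h : MvPolynomial.aeval P.coords F = 0) {x : ProjPlane K} (hx : ¬ VanishesAt F x) :
    (fibreFunction P.coords x.rep).natDegree = 0 := by
  by_contra hdeg
  obtain ⟨f, hf, hdvd⟩ := exists_irreducible_of_natDegree_ne_zero hdeg
  exact hf.not_isUnit (P.gcd_eq_one f (dvd_of_prime_of_dvd_fibreFunction hf.prime hdvd hF h hx))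

theorem rootMultiplicity_fibreFunction_reversedCoords_eq_zero [Infinite K]
    (hF : F.IsHomogeneous n) (h : MvPolynomial.aeval P.coords F = 0) {x : ProjPlane K}
    (hx : ¬ VanishesAt F x) : (fibreFunction P.reversedCoords x.rep).rootMultiplicity 0 = 0 := by
  by_contra hmult
  have hdvd : X ∣ fibreFunction P.reversedCoords x.rep := by
    have hroot := (rootMultiplicity_pos'.1 (Nat.pos_of_ne_zero hmult)).2
    simpa using dvd_iff_isRoot.2 hroot
  refine P.coeff_deg_ne_zero (funext fun i => ?_)
  rw [Pi.zero_apply, ← eval_zero_reversedCoords, ← coeff_zero_eq_eval_zero, ← X_dvd_iff]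
  exact dvd_of_prime_of_dvd_fibreFunction prime_X hdvd hF (aeval_reversedCoords_eq_zero hF h) hx i

theorem IsProper.ne_zero_and_orderAt_add_deg (hP : P.IsProper) (hLI : LinearIndependent K P.coords)
    (hF : F.IsHomogeneous n) (h : IsRelationGenerator F P.coords) (x : ProjPlane K) :
    F ≠ 0 ∧ orderAt F x + P.deg = n + (fibreFunction P.coords x.rep).natDegree +
      (fibreFunction P.reversedCoords x.rep).rootMultiplicity 0 := by
  obtain ⟨M, N, hMN, hcol⟩ := exists_mul_eq_one_and_col_eq 0 x.rep_nonzero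
  obtain ⟨h0, hdeg⟩ := hP.ne_zero_and_degreeOf_bind₁_eq_finrank hLI hMN h
  have horder := orderAt_add_degreeOf_pencil hF h0 x
  have hfinrank := finrank_add_natDegree_add_rootMultiplicity hMN hLI
  rw [← hcol, degreeOf_pencil_col_zero hMN, hdeg] at horder
  rw [hcol] at hfinrank
  exact ⟨h0, by lia⟩

theorem IsProper.degree_eq_deg [Infinite K] (hP : P.IsProper) (hLI : LinearIndependent K P.coords)
    (hF : F.IsHomogeneous n) (h : IsRelationGenerator F P.coords) : n = P.deg := by
  have h0 := (hP.ne_zero_and_orderAt_add_deg hLI hF h P.limitPoint).1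
  obtain ⟨x, hx⟩ := exists_not_vanishesAt hF h0
  have hsum := (hP.ne_zero_and_orderAt_add_deg hLI hF h x).2
  rw [orderAt_eq_zero_of_not_vanishesAt hx,
    natDegree_fibreFunction_eq_zero hF h.aeval_eq_zero hx,
    rootMultiplicity_fibreFunction_reversedCoords_eq_zero hF h.aeval_eq_zero hx] at hsum
  lia

theorem IsProper.curveMultiplicity_eq [Infinite K] (hP : P.IsProper)
    (hLI : LinearIndependent K P.coords) (x : ProjPlane K) :
    curveMultiplicity P.curve x = (fibreFunction P.coords x.rep).natDegree +
      (fibreFunction P.reversedCoords x.rep).rootMultiplicity 0 := by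
  have horder {F : MvPolynomial (Fin 3) K} (hF : IsRelationGenerator F P.coords) :
      orderAt F x = (fibreFunction P.coords x.rep).natDegree +
        (fibreFunction P.reversedCoords x.rep).rootMultiplicity 0 := by
    obtain ⟨n, hn⟩ := hF.1
    have hdeg := hP.degree_eq_deg hLI hn hF
    have hsum := (hP.ne_zero_and_orderAt_add_deg hLI hn hF x).2
    lia
  obtain ⟨F, hF⟩ := exists_isRelationGenerator_coords hLI
  rw [curveMultiplicity, ← csInf_singleton (_ + _)]
  congr 1
  ext m
  simp only [isDefiningForm_curve_iff, Set.mem_ofPred_eq, Set.mem_singleton_iff]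
  exact ⟨fun ⟨G, hG, hm⟩ => hm ▸ horder hG, fun hm => ⟨F, hF, hm ▸ horder hF⟩⟩

end DegreeOfCurve

section Fibres

theorem linearIndependent_reversedCoords (hLI : LinearIndependent K P.coords) :
    LinearIndependent K P.reversedCoords := by
  rw [Fintype.linearIndependent_iff] at hLI ⊢
  intro a ha
  refine hLI a ((reflect_eq_zero_iff (N := P.deg)).1 ?_)
  rw [← ha]
  ext k
  simp [reversedCoords, finsetSum_coeff, coeff_reflect]

theorem point_mem_curve (P : PlaneParametrization K) (t : K) : P.point t ∈ P.curve :=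
  fun _ hF => hF.2 _ ⟨t, rfl⟩

theorem X_sub_C_dvd_fibreFunction_point_rep (P : PlaneParametrization K) (t : K) :
    X - C t ∣ fibreFunction P.coords (P.point t).rep := by
  obtain ⟨a, ha⟩ := Projectivization.exists_smul_eq_mk_rep K _ (P.eval_ne_zero t)
  rw [point, ← ha]
  exact X_sub_C_dvd_fibreFunction (a : K)

theorem X_dvd_fibreFunction_limitPoint_rep (P : PlaneParametrization K) :
    X ∣ fibreFunction P.reversedCoords P.limitPoint.rep := by
  obtain ⟨a, ha⟩ := Projectivization.exists_smul_eq_mk_rep K _ P.coeff_deg_ne_zero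
  rw [limitPoint, ← ha, ← sub_zero X, ← map_zero C]
  simp only [← eval_zero_reversedCoords]
  exact X_sub_C_dvd_fibreFunction (a : K)

theorem one_le_visibleMultiplicity (hLI : LinearIndependent K P.coords) {t : K}
    (ht : P.point t = P.limitPoint) : 1 ≤ P.visibleMultiplicity := by
  rw [visibleMultiplicity, ← ht, ← natDegree_X_sub_C t]
  exact natDegree_le_of_dvd (P.X_sub_C_dvd_fibreFunction_point_rep t)
    (fibreFunction_ne_zero hLI (P.point t).rep_nonzero)

theorem one_le_hiddenMultiplicity (hLI : LinearIndependent K P.coords) :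
    1 ≤ P.hiddenMultiplicity := by
  rw [hiddenMultiplicity, le_rootMultiplicity_iff (fibreFunction_ne_zero
    (linearIndependent_reversedCoords hLI) P.limitPoint.rep_nonzero), map_zero, sub_zero, pow_one]
  exact P.X_dvd_fibreFunction_limitPoint_rep

end Fibres

section LinearIndependence

theorem coords_ne_zero (P : PlaneParametrization K) : P.coords ≠ 0 := fun h =>
  P.eval_ne_zero 0 (by simp [h, Pi.zero_def])

theorem IsProper.max_natDegree_eq_one (hP : P.IsProper) {α β : K[X]} {a b : Fin 3 → K}
    (h : ∀ i, P.coords i = C (a i) * α + C (b i) * β) : max α.natDegree β.natDegree = 1 := by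
  wlog hβ : β ≠ 0 generalizing α β a b
  · rw [not_not] at hβ
    rw [max_comm]
    refine this (fun i => (h i).trans (add_comm _ _)) fun hα => P.coords_ne_zero ?_
    ext1 i
    rw [h, hα, hβ, mul_zero, mul_zero, add_zero, Pi.zero_apply]
  have hz : algebraMap K[X] (RatFunc K) β ≠ 0 :=
    (map_ne_zero_iff _ (IsFractionRing.injective K[X] (RatFunc K))).2 hβ
  have htop : K⟮algebraMap K[X] (RatFunc K) α / algebraMap K[X] (RatFunc K) β⟯ = ⊤ := by
    refine hP.eq_top_of_div_mem hz fun i => ?_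
    have hdiv : algebraMap K[X] (RatFunc K) (P.coords i) / algebraMap K[X] (RatFunc K) β =
        algebraMap K (RatFunc K) (a i) *
          (algebraMap K[X] (RatFunc K) α / algebraMap K[X] (RatFunc K) β) +
        algebraMap K (RatFunc K) (b i) := by
      rw [h, map_add, map_mul, map_mul, add_div, mul_div_cancel_right₀ _ hz, mul_div_assoc,
        RatFunc.algebraMap_C, RatFunc.algebraMap_C, RatFunc.algebraMap_eq_C]
    rw [hdiv]
    exact add_mem (mul_mem (IntermediateField.algebraMap_mem _ _) (mem_adjoin_simple_self K _))
      (IntermediateField.algebraMap_mem _ _)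
  have hgcd (f : K[X]) : f ∣ 1 ↔ f ∣ α ∧ f ∣ β := by
    rw [← isUnit_iff_dvd_one]
    refine ⟨fun hf => ⟨hf.dvd, hf.dvd⟩, fun ⟨hα, hβ⟩ => P.gcd_eq_one f fun i => ?_⟩
    rw [h]
    exact dvd_add (hα.mul_left _) (hβ.mul_left _)
  rw [← finrank_adjoin_div_add_natDegree hβ hgcd, htop, IntermediateField.finrank_top,
    natDegree_one]

theorem IsProper.deg_le_one_of_not_linearIndependent (hP : P.IsProper)
    (hdep : ¬ LinearIndependent K P.coords) : P.deg ≤ 1 := by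
  obtain ⟨g, hg, i, hi⟩ := Fintype.not_linearIndependent_iff.1 hdep
  obtain ⟨A, B, hAB, rfl⟩ := exists_mul_eq_one_and_col_eq 0 fun h => hi (congrFun h i)
  have hBA : Bᵀ * Aᵀ = 1 := by rw [← Matrix.transpose_mul, hAB, Matrix.transpose_one]
  have hzero : frameCoords Aᵀ P.coords 0 = 0 := by
    simp only [← hg, frameCoords, Matrix.mulVec, dotProduct, Matrix.map_apply,
      Matrix.transpose_apply, Matrix.col_apply, smul_eq_C_mul]
  have hcoords (i : Fin 3) : P.coords i = C (Bᵀ i 1) * frameCoords Aᵀ P.coords 1 +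
      C (Bᵀ i 2) * frameCoords Aᵀ P.coords 2 := by
    conv_lhs => rw [coords_eq_sum_frameCoords hBA, Fin.sum_univ_three, hzero, mul_zero, zero_add]
  have hmax := hP.max_natDegree_eq_one hcoords
  refine Finset.sup_le fun i _ => ?_
  rw [hcoords, ← hmax]
  exact natDegree_add_le_of_le (natDegree_C_mul_le _ _) (natDegree_C_mul_le _ _)

theorem C_mul_coords_eq_of_point_eq_limitPoint (hdeg : P.deg ≤ 1) {t : K}
    (ht : P.point t = P.limitPoint) (i j : Fin 3) :
    C (P.limitPoint.rep i) * P.coords j = C (P.limitPoint.rep j) * P.coords i := by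
  rw [← sub_eq_zero]
  by_contra hne
  have hdvd : X - C t ∣ C (P.limitPoint.rep i) * P.coords j - C (P.limitPoint.rep j) * P.coords i :=
    dvd_fibreFunction_iff.1 (ht ▸ P.X_sub_C_dvd_fibreFunction_point_rep t) i j
  have hone := natDegree_le_of_dvd hdvd hne
  have hle := natDegree_sub_le_of_le
    ((natDegree_C_mul_le (P.limitPoint.rep i) _).trans (P.natDegree_coords_le j))
    ((natDegree_C_mul_le (P.limitPoint.rep j) _).trans (P.natDegree_coords_le i))
  obtain ⟨a, ha⟩ := Projectivization.exists_smul_eq_mk_rep K _ P.coeff_deg_ne_zero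
  have hcoeff (k : Fin 3) : P.limitPoint.rep k = a * (P.coords k).coeff P.deg :=
    (congrFun ha k).symm
  rw [natDegree_X_sub_C] at hone
  refine hne (leadingCoeff_eq_zero.1 ?_)
  rw [leadingCoeff, show natDegree _ = P.deg by lia, coeff_sub, coeff_C_mul, coeff_C_mul, hcoeff,
    hcoeff]
  ring

theorem IsProper.linearIndependent_coords (hP : P.IsProper) {t : K}
    (ht : P.point t = P.limitPoint) : LinearIndependent K P.coords := by
  by_contra hdep
  obtain ⟨i, hi⟩ := Function.ne_iff.1 P.limitPoint.rep_nonzero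
  have hprop (j : Fin 3) :
      P.coords j = C (P.limitPoint.rep j) * (C (P.limitPoint.rep i)⁻¹ * P.coords i) := by
    rw [mul_left_comm, ← C_mul_coords_eq_of_point_eq_limitPoint
      (hP.deg_le_one_of_not_linearIndependent hdep) ht, ← mul_assoc, ← C_mul, inv_mul_cancel₀ hi,
      C_1, one_mul]
  have hunit : IsUnit (C (P.limitPoint.rep i)⁻¹ * P.coords i) :=
    P.gcd_eq_one _ fun j => ⟨_, (hprop j).trans (mul_comm _ _)⟩
  have hmax := hP.max_natDegree_eq_one (α := 0) (β := C (P.limitPoint.rep i)⁻¹ * P.coords i)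
    (a := 0) (b := P.limitPoint.rep) fun j => by rw [mul_zero, zero_add]; exact hprop j
  rw [natDegree_eq_zero_of_isUnit hunit, natDegree_zero] at hmax
  exact absurd hmax (by decide)

end LinearIndependence

end PlaneParametrization

theorem mainTheorem4_general {K : Type*} [Field K] [Infinite K] (P : PlaneParametrization K)
    (hproper : P.IsProper) (hreached : ∃ t₀ : K, P.point t₀ = P.limitPoint) :
    IsSingularPoint P.curve P.limitPoint ∧
      1 ≤ P.visibleMultiplicity ∧ 1 ≤ P.hiddenMultiplicity ∧
      curveMultiplicity P.curve P.limitPoint =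
        P.visibleMultiplicity + P.hiddenMultiplicity := by
  obtain ⟨t₀, ht₀⟩ := hreached
  have hLI : LinearIndependent K P.coords := hproper.linearIndependent_coords ht₀
  have hvisible := PlaneParametrization.one_le_visibleMultiplicity hLI ht₀
  have hhidden := PlaneParametrization.one_le_hiddenMultiplicity hLI
  have hmult : curveMultiplicity P.curve P.limitPoint =
      P.visibleMultiplicity + P.hiddenMultiplicity := hproper.curveMultiplicity_eq hLI _
  have hmem : P.limitPoint ∈ P.curve := ht₀ ▸ P.point_mem_curve t₀
  exact ⟨⟨hmem, hmult ▸ add_le_add hvisible hhidden⟩, hvisible, hhidden, hmult⟩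

theorem mainTheorem4 {K : Type*} [Field K] [IsAlgClosed K] [CharZero K]
    (P : PlaneParametrization K) (hproper : P.IsProper) (hline : ¬ IsProjLine P.curve)
    (hreached : ∃ t₀ : K, P.point t₀ = P.limitPoint) :
    IsSingularPoint P.curve P.limitPoint ∧
      1 ≤ P.visibleMultiplicity ∧ 1 ≤ P.hiddenMultiplicity ∧
      curveMultiplicity P.curve P.limitPoint =
        P.visibleMultiplicity + P.hiddenMultiplicity := by
  have : Infinite K := IsAlgClosed.instInfinite
  exact mainTheorem4_general P hproper hreached
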